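/- Let $q$ be a prime power and let $n\ge 3$ and $1\le d\le q$ be integers. A matrix $H\neq 0$ with entries in $\mathbb F_{q^2}$ is called Hermitian if $H^T=H^{(q)}$, where $H^{(q)}$ is obtained from $H$ by raising every entry to the $q$-th power; an $(m+1)\times(m+1)$ Hermitian matrix $H$ defines the Hermitian variety $V(x^THx^{(q)})\subset\mathbb P^m$, where $x=(x_0,\dots,x_m)^T$ and $x^{(q)}=(x_0^q,\dots,x_m^q)^T$. Its rank is the rank of $H$, and it is non-degenerate if this rank is $m+1$. Let $P\mathcal U_{n-1}$ be a Hermitian variety of rank $n$ in $\mathbb P^n$ and let $\mathcal U_{n-1}$ be a non-degenerate Hermitian variety in $\mathbb P^{n-1}$, both over $\mathbb F_{q^2}$. Let $F\in\mathbb F_{q^2}[x_0,\dots,x_n]$ be a nonzero homogeneous polynomial of degree $d$, and let $V(F)\subset\mathbb P^n$ be the hypersurface it defines. Then $$|(P\mathcal U_{n-1}\cap V(F))(\mathbb F_{q^2})|\le \max\left\{|\mathcal U_{n-1}(\mathbb F_{q^2})|+(d-1)(q+1)q^{2n-4},\ 1+q^2M_{n-1}(d)\right\},$$ where $M_{n-1}(d):=\max_{G}|(\mathcal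 U_{n-1}\cap V(G))(\mathbb F_{q^2})|$, the maximum being taken over all nonzero homogeneous polynomials $G\in\mathbb F_{q^2}[x_0,\dots,x_{n-1}]$ of degree $d$. -/

import Mathlib

open scoped LinearAlgebra.Projectivization

noncomputable section

/-- The set of `K`-rational points of the projective hypersurface `V(F)`. For homogeneous `F` the
choice of the representative is irrelevant, see `mk_mem_projZeros`. -/
def projZeros {K σ : Type*} [Field K] (F : MvPolynomial σ K) : Set (ℙ K (σ → K)) :=
  {P | MvPolynomial.eval P.rep F = 0}

theorem mk_mem_projZeros {K σ : Type*} [Field K] {F : MvPolynomial σ K} {d : ℕ}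
    (hF : F.IsHomogeneous d) (v : σ → K) (hv : v ≠ 0) :
    Projectivization.mk K v hv ∈ projZeros F ↔ MvPolynomial.eval v F = 0 := by
  obtain ⟨a, ha⟩ := Projectivization.exists_smul_eq_mk_rep K v hv
  have h : MvPolynomial.eval (a • v) F = (a : K) ^ d * MvPolynomial.eval v F := by
    rw [MvPolynomial.eval_eq, MvPolynomial.eval_eq, Finset.mul_sum]
    refine Finset.sum_congr rfl fun m hm => ?_
    have hdeg : ∑ i ∈ m.support, m i = d := by
      have := hF (MvPolynomial.mem_support_iff.mp hm)
      simpa [Finsupp.weight_apply, Finsupp.sum] using this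
    simp only [Pi.smul_apply, Units.smul_def, smul_eq_mul, mul_pow, Finset.prod_mul_distrib,
      Finset.prod_pow_eq_pow_sum, hdeg]
    ring
  change MvPolynomial.eval (Projectivization.mk K v hv).rep F = 0 ↔ _
  rw [← ha, h]
  simp

/-- Hermitian matrices over the field with `q ^ 2` elements: `H ≠ 0` and `Hᵀ = H^(q)`. -/
def IsHermitianMatrix {K ι : Type*} [Field K] (q : ℕ) (H : Matrix ι ι K) : Prop :=
  H ≠ 0 ∧ H.transpose = H.map (fun a => a ^ q)

/-- The polynomial `xᵀ H x^(q)` defining the Hermitian variety of `H`. -/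
def hermitianPoly {K ι : Type*} [Field K] [Fintype ι] (q : ℕ) (H : Matrix ι ι K) :
    MvPolynomial ι K :=
  ∑ i, ∑ j, MvPolynomial.C (H i j) * MvPolynomial.X i * MvPolynomial.X j ^ q

theorem hermitianPoly_isHomogeneous {K ι : Type*} [Field K] [Fintype ι] (q : ℕ)
    (H : Matrix ι ι K) : (hermitianPoly q H).IsHomogeneous (q + 1) := by
  refine MvPolynomial.IsHomogeneous.sum _ _ _ fun i _ =>
    MvPolynomial.IsHomogeneous.sum _ _ _ fun j _ => ?_
  have h := ((MvPolynomial.isHomogeneous_C ι (H i j)).mul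
    (MvPolynomial.isHomogeneous_X K i)).mul ((MvPolynomial.isHomogeneous_X K j).pow q)
  convert h using 1
  ring

/-- The set of rational points of the Hermitian variety of `H`. -/
def hermitianPoints {K ι : Type*} [Field K] [Fintype ι] (q : ℕ) (H : Matrix ι ι K) :
    Set (ℙ K (ι → K)) :=
  projZeros (hermitianPoly q H)

/-- The numbers of rational points that the Hermitian variety of `H` shares with the
hypersurfaces of degree `d`. -/
def hermitianIntersectionNumbers {K ι : Type*} [Field K] [Fintype ι] (q d : ℕ)
    (H : Matrix ι ι K) : Set ℕ :=
  {m | ∃ G : MvPolynomial ι K, G.IsHomogeneous d ∧ G ≠ 0 ∧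
    m = (hermitianPoints q H ∩ projZeros G).ncard}

/-- The maximal number of rational points that a hypersurface of degree `d` shares with the
Hermitian variety of `H`. -/
def hermitianMax {K ι : Type*} [Field K] [Fintype ι] (q d : ℕ) (H : Matrix ι ι K) : ℕ :=
  sSup (hermitianIntersectionNumbers q d H)

theorem hermitianMax_isGreatest {K ι : Type*} [Field K] [Finite K] [Fintype ι] [Nonempty ι]
    (q d : ℕ) (H : Matrix ι ι K) :
    IsGreatest (hermitianIntersectionNumbers q d H) (hermitianMax q d H) := by
  have hne : (hermitianIntersectionNumbers q d H).Nonempty := by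
    obtain ⟨i⟩ := ‹Nonempty ι›
    refine ⟨_, MvPolynomial.X i ^ d, ?_, pow_ne_zero _ (MvPolynomial.X_ne_zero i), rfl⟩
    simpa using (MvPolynomial.isHomogeneous_X K i).pow d
  have hbdd : BddAbove (hermitianIntersectionNumbers q d H) := by
    refine ⟨(hermitianPoints q H).ncard, ?_⟩
    rintro _ ⟨G, -, -, rfl⟩
    exact Set.ncard_le_ncard Set.inter_subset_left (Set.toFinite _)
  exact ⟨Nat.sSup_mem hne hbdd, fun _ hm => le_csSup hbdd hm⟩

end

/-!
The Hermitian variety of rank `n` is a cone over the non-degenerate one. In coordinates where the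
vertex is the first coordinate point, its equation does not involve the first coordinate, and `F`
is a polynomial in that coordinate of some degree `e ≤ d` whose leading coefficient `G` is a form of
degree `d - e` in the others. Over a point `x` of the affine cone over the base, `F` has at most
`e` zeros if `G x ≠ 0` and at most `q ^ 2` if `G x = 0`. For `e = 0` this count is the second
bound. For `e ≥ 1` the first one follows from `|U ∩ V(G)| ≤ (d - e) (q + 1) q ^ (2 n - 4)` for the
affine cones. To obtain this inequality, take an isotropic vector `p` off `V(G)` and an anisotropic
`v` orthogonal to `p`: on every translate of the plane spanned by `p` and `v`, Bézout's theorem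
leaves at most `(d - e) (q + 1)` common zeros, and the translates cover the space uniformly.
-/

open MvPolynomial
open scoped MonomialOrder Matrix

theorem eval_aeval {R σ ι : Type*} [CommSemiring R] (x : σ → R) (g : ι → MvPolynomial σ R)
    (G : MvPolynomial ι R) : eval x (aeval g G) = eval (fun i => eval x (g i)) G :=
  aeval_bind₁ x g G

section Footprint

variable {K σ : Type*} [Field K]

/-- Evaluations at distinct points are linearly independent (Dedekind), and here they are
determined by their values on the monomials with exponent in `box`. -/
theorem ncard_le_card_of_forall_exists_eval_eq [Finite σ] {Z : Set (σ → K)}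
    {box : Finset (σ →₀ ℕ)} (hZ : ∀ g : MvPolynomial σ K, ∃ r : MvPolynomial σ K,
      r.support ⊆ box ∧ ∀ x ∈ Z, eval x r = eval x g) : Z.ncard ≤ box.card := by
  have := Fintype.ofFinite σ
  choose r r_support eval_r using hZ
  let evalMonomials (x : Z) (c : box) : K := ∏ i, x.1 i ^ (c : σ →₀ ℕ) i
  let evalFromMonomials : (box → K) →ₗ[K] MvPolynomial σ K → K :=
    LinearMap.pi fun g => ∑ c : box, coeff c (r g) • LinearMap.proj c
  have evalFromMonomials_comp : ⇑evalFromMonomials ∘ evalMonomials =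
      (fun φ : MvPolynomial σ K →* K => (φ : MvPolynomial σ K → K)) ∘
        fun x : Z => (eval x.1 : MvPolynomial σ K →* K) := by
    ext x g
    simp only [Function.comp_apply, evalFromMonomials, evalMonomials, LinearMap.pi_apply,
      LinearMap.sum_apply, LinearMap.smul_apply, LinearMap.proj_apply, smul_eq_mul]
    rw [Finset.sum_coe_sort box fun c => coeff c (r g) * ∏ i, x.1 i ^ c i,
      ← Finset.sum_subset (r_support g) fun c _ hc => by
        rw [notMem_support_iff.mp hc, zero_mul], ← eval_eq']
    exact eval_r g x x.2
  have indep : LinearIndependent K evalMonomials := by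
    refine LinearIndependent.of_comp evalFromMonomials (evalFromMonomials_comp ▸ ?_)
    refine (linearIndependent_monoidHom (MvPolynomial σ K) K).comp _ fun x y hxy => ?_
    ext i
    simpa using DFunLike.congr_fun hxy (X i)
  have := indep.finite
  have := Fintype.ofFinite Z
  calc Z.ncard = Fintype.card Z := by rw [← Nat.card_coe_set_eq, Nat.card_eq_fintype_card]
    _ ≤ Module.finrank K (box → K) := indep.fintype_card_le_finrank
    _ = box.card := by rw [Module.finrank_fintype_fun_eq_card, Fintype.card_coe]

theorem ncard_zeros_le_prod_of_degree_eq_single [Fintype σ] (m : MonomialOrder σ)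
    {f : σ → MvPolynomial σ K} {a : σ → ℕ} (hf : ∀ i, f i ≠ 0)
    (hdeg : ∀ i, m.degree (f i) = Finsupp.single i (a i)) :
    {x | ∀ i, eval x (f i) = 0}.ncard ≤ ∏ i, a i := by
  classical
  let box : Finset (σ →₀ ℕ) := Finset.univ.finsupp fun i => Finset.range (a i)
  have hunit (i : σ) : IsUnit (m.leadingCoeff (f i)) :=
    (m.leadingCoeff_ne_zero_iff.mpr (hf i)).isUnit
  have box_card : box.card = ∏ i, a i := by simp [box, Finset.card_finsupp]
  refine box_card ▸ ncard_le_card_of_forall_exists_eval_eq fun g => ?_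
  obtain ⟨s, r, hsr, -, hr⟩ := m.div hunit g
  refine ⟨r, fun c hc => Finset.mem_finsupp_iff.mpr ⟨Finset.subset_univ _, fun i _ => ?_⟩,
    fun x hx => ?_⟩
  · simpa [hdeg, Finsupp.single_le_iff] using hr c hc i
  · rw [Set.mem_ofPred_eq] at hx
    simp [hsr, Finsupp.linearCombination_apply, Finsupp.sum, hx]

end Footprint

section LeadingTerms

theorem prod_map_toMultiset {ι M : Type*} [CommMonoid M] (g : ι → M) (c : ι →₀ ℕ) :
    (c.toMultiset.map g).prod = c.prod fun i n => g i ^ n := by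
  rw [Finsupp.toMultiset_map, Finsupp.prod_toMultiset,
    Finsupp.prod_mapDomain_index (fun _ => pow_zero _) fun _ => pow_add _]

theorem card_toMultiset_of_mem_support {R ι : Type*} [CommSemiring R] {G : MvPolynomial ι R}
    {k : ℕ} (hG : G.IsHomogeneous k) {c : ι →₀ ℕ} (hc : c ∈ G.support) :
    c.toMultiset.card = k := by
  rw [Finsupp.card_toMultiset, ← hG (mem_support_iff.mp hc)]
  simp [Finsupp.weight_apply, Finsupp.sum]

variable {R σ ι : Type*} [CommRing R] {m : MonomialOrder σ} {a : σ →₀ ℕ}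

theorem degree_multiset_prod_le_card_nsmul {S : Multiset (MvPolynomial σ R)}
    (hS : ∀ f ∈ S, m.degree f ≼[m] a) : m.degree S.prod ≼[m] S.card • a := by
  induction S using Multiset.induction with
  | empty => simp
  | cons f S ih =>
    rw [Multiset.forall_mem_cons] at hS
    rw [Multiset.prod_cons, Multiset.card_cons, succ_nsmul']
    refine m.degree_mul_le.trans ?_
    rw [map_add, map_add]
    exact add_le_add hS.1 (ih hS.2)

theorem coeff_card_nsmul_multiset_prod {S : Multiset (MvPolynomial σ R)}
    (hS : ∀ f ∈ S, m.degree f ≼[m] a) :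
    coeff (S.card • a) S.prod = (S.map (coeff a)).prod := by
  induction S using Multiset.induction with
  | empty => simp
  | cons f S ih =>
    rw [Multiset.forall_mem_cons] at hS
    rw [Multiset.prod_cons, Multiset.card_cons, succ_nsmul', Multiset.map_cons,
      Multiset.prod_cons, m.coeff_mul_of_add_of_degree_le hS.1
        (degree_multiset_prod_le_card_nsmul hS.2), ih hS.2]

variable {L : ι → MvPolynomial σ R} {G : MvPolynomial ι R} {k : ℕ}

theorem aeval_eq_sum_prod_map_toMultiset (L : ι → MvPolynomial σ R) (G : MvPolynomial ι R) :
    aeval L G = ∑ c ∈ G.support, C (coeff c G) * (c.toMultiset.map L).prod := by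
  simp only [aeval_def, eval₂_eq, prod_map_toMultiset]
  rfl

theorem degree_aeval_le_nsmul (hG : G.IsHomogeneous k) (hL : ∀ l, m.degree (L l) ≼[m] a) :
    m.degree (aeval L G) ≼[m] k • a := by
  rw [aeval_eq_sum_prod_map_toMultiset]
  refine m.degree_sum_le.trans (Finset.sup_le fun c hc => m.degree_mul_le.trans ?_)
  rw [m.degree_C, zero_add, ← card_toMultiset_of_mem_support hG hc, ← Multiset.card_map L]
  exact degree_multiset_prod_le_card_nsmul (by simpa using fun l _ => hL l)

theorem coeff_nsmul_aeval (hG : G.IsHomogeneous k) (hL : ∀ l, m.degree (L l) ≼[m] a) :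
    coeff (k • a) (aeval L G) = eval (fun l => coeff a (L l)) G := by
  rw [aeval_eq_sum_prod_map_toMultiset, coeff_sum, eval_eq]
  refine Finset.sum_congr rfl fun c hc => ?_
  rw [coeff_C_mul, ← card_toMultiset_of_mem_support hG hc, ← Multiset.card_map L,
    coeff_card_nsmul_multiset_prod (by simpa using fun l _ => hL l), Multiset.map_map,
    prod_map_toMultiset]
  rfl

theorem degree_aeval_eq_nsmul (hG : G.IsHomogeneous k) (hL : ∀ l, m.degree (L l) ≼[m] a)
    (hne : eval (fun l => coeff a (L l)) G ≠ 0) : m.degree (aeval L G) = k • a :=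
  m.toSyn.injective <| (degree_aeval_le_nsmul hG hL).antisymm <|
    m.le_degree <| mem_support_iff.mpr <| by rwa [coeff_nsmul_aeval hG hL]

end LeadingTerms

section DegLex

variable {R σ : Type*} [CommRing R] [LinearOrder σ] [WellFoundedGT σ]

theorem degLex_lt_of_degree_lt {c e : σ →₀ ℕ} (h : c.degree < e.degree) :
    c ≺[MonomialOrder.degLex] e :=
  MonomialOrder.degLex_lt_iff.mpr <| Finsupp.DegLex.lt_iff.mpr <| Or.inl h

theorem degLex_degree_C_mul_X_pow_add {a : R} (ha : a ≠ 0) (i : σ) {N : ℕ}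
    {r : MvPolynomial σ R} (hr : r.totalDegree < N) :
    MonomialOrder.degLex.degree (C a * X i ^ N + r) = Finsupp.single i N := by
  classical
  have leading : MonomialOrder.degLex.degree (C a * X i ^ N) = Finsupp.single i N := by
    rw [C_mul_X_pow_eq_monomial, MonomialOrder.degree_monomial, if_neg ha]
  have pos : 0 ≺[MonomialOrder.degLex] Finsupp.single i N :=
    degLex_lt_of_degree_lt (by simpa using Nat.zero_lt_of_lt hr)
  rw [MonomialOrder.degree_add_of_lt, leading]
  rw [leading, MonomialOrder.degLex.degree_lt_iff pos]
  exact fun c hc => degLex_lt_of_degree_lt <|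
    ((le_totalDegree hc).trans_lt hr).trans_eq (Finsupp.degree_single i N).symm

end DegLex

section PlaneBezout

variable {K ι : Type*} [Field K]

/-- The affine plane through `u` with directions `p` and `v`, as a family of affine linear
polynomials in the two plane coordinates, one for each coordinate of the ambient space. -/
noncomputable def planeParametrization (u p v : ι → K) (l : ι) : MvPolynomial (Fin 2) K :=
  C (u l) + C (p l) * X 0 + C (v l) * X 1

theorem eval_aeval_planeParametrization (u p v : ι → K) (G : MvPolynomial ι K) (z : Fin 2 → K) :
    eval z (aeval (planeParametrization u p v) G) = eval (u + z 0 • p + z 1 • v) G := by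
  rw [eval_aeval]
  congr 2
  ext l
  simp [planeParametrization, mul_comm]

theorem degLex_degree_planeParametrization_le (u p v : ι → K) (l : ι) :
    MonomialOrder.degLex.degree (planeParametrization u p v l) ≼[MonomialOrder.degLex]
      Finsupp.single 0 1 := by
  have le_X (i : Fin 2) (c : K) : MonomialOrder.degLex.degree (C c * X i)
      ≼[MonomialOrder.degLex] Finsupp.single 0 1 := by
    rw [C_mul_X_eq_monomial]
    exact (MonomialOrder.degLex.degree_monomial_le c).trans
      (MonomialOrder.degLex_single_le_iff.mpr (Fin.zero_le i))
  refine MonomialOrder.degLex.degree_add_le.trans (sup_le ?_ (le_X 1 _))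
  refine MonomialOrder.degLex.degree_add_le.trans (sup_le ?_ (le_X 0 _))
  simp [MonomialOrder.degLex.degree_C]

theorem coeff_single_zero_planeParametrization (u p v : ι → K) (l : ι) :
    coeff (Finsupp.single 0 1) (planeParametrization u p v l) = p l := by
  simp [planeParametrization, coeff_C, coeff_C_mul, coeff_X, Finsupp.single_left_inj,
    eq_comm (a := (0 : Fin 2 →₀ ℕ))]

theorem coeff_single_zero_aeval_planeParametrization {G : MvPolynomial ι K} {k : ℕ}
    (hG : G.IsHomogeneous k) (u p v : ι → K) :
    coeff (Finsupp.single 0 k) (aeval (planeParametrization u p v) G) = eval p G := by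
  rw [← Finsupp.smul_single_one,
    coeff_nsmul_aeval hG (degLex_degree_planeParametrization_le u p v)]
  simp only [coeff_single_zero_planeParametrization]

theorem degLex_degree_aeval_planeParametrization {G : MvPolynomial ι K} {k : ℕ}
    (hG : G.IsHomogeneous k) (u v : ι → K) {p : ι → K} (hp : eval p G ≠ 0) :
    MonomialOrder.degLex.degree (aeval (planeParametrization u p v) G) = Finsupp.single 0 k := by
  rw [degree_aeval_eq_nsmul hG (degLex_degree_planeParametrization_le u p v)
    (by simpa only [coeff_single_zero_planeParametrization] using hp), Finsupp.smul_single_one]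

/-- Choosing the direction `p` of the first coordinate off `V(G)` makes the leading terms of the
two curves pure powers of different variables. -/
theorem ncard_plane_zeros_le {G : MvPolynomial ι K} {k N : ℕ} (hG : G.IsHomogeneous k)
    (u v : ι → K) {p : ι → K} (hp : eval p G ≠ 0) {a : K} (ha : a ≠ 0)
    {r : MvPolynomial (Fin 2) K} (hr : r.totalDegree < N) :
    {z : Fin 2 → K | eval (u + z 0 • p + z 1 • v) G = 0 ∧
      eval z (C a * X 1 ^ N + r) = 0}.ncard ≤ k * N := by
  let f : Fin 2 → MvPolynomial (Fin 2) K :=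
    ![aeval (planeParametrization u p v) G, C a * X 1 ^ N + r]
  have hdeg (i : Fin 2) : MonomialOrder.degLex.degree (f i) = Finsupp.single i (![k, N] i) := by
    fin_cases i
    · exact degLex_degree_aeval_planeParametrization hG u v hp
    · exact degLex_degree_C_mul_X_pow_add ha 1 hr
  have hf (i : Fin 2) : f i ≠ 0 := by
    fin_cases i
    · refine ne_zero_iff.mpr ⟨Finsupp.single 0 k, ?_⟩
      rwa [← coeff_single_zero_aeval_planeParametrization hG u p v] at hp
    · refine MonomialOrder.degLex.ne_zero_of_degree_ne_zero ?_
      rw [hdeg]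
      simpa using (Nat.zero_lt_of_lt hr).ne'
  calc _ = {z | ∀ i, eval z (f i) = 0}.ncard := by
        simp only [Fin.forall_fin_two, f, ← eval_aeval_planeParametrization]
        rfl
    _ ≤ ∏ i, ![k, N] i := ncard_zeros_le_prod_of_degree_eq_single _ hf hdeg
    _ = k * N := by simp

end PlaneBezout

theorem card_pow_fiber_of_card_eq_mul {G : Type*} [CommGroup G] [IsCyclic G] [Finite G] {l m : ℕ}
    (hG : Nat.card G = l * m) {x : G} (hx : x ^ m = 1) : {y : G | y ^ l = x}.ncard = l := by
  have hl : 0 < l := Nat.pos_of_mul_pos_right (hG ▸ Nat.card_pos)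
  have range_eq_ker : (powMonoidHom l : G →* G).range = (powMonoidHom m : G →* G).ker := by
    refine Subgroup.eq_of_le_of_card_ge ?_ ?_
    · rintro _ ⟨y, rfl⟩
      rw [MonoidHom.mem_ker, powMonoidHom_apply, powMonoidHom_apply, ← pow_mul, ← hG,
        pow_card_eq_one']
    · rw [IsCyclic.card_powMonoidHom_range, IsCyclic.card_powMonoidHom_ker, hG,
        Nat.gcd_mul_left_left, Nat.gcd_mul_right_left, Nat.mul_div_cancel_left m hl]
  obtain ⟨y, rfl⟩ : x ∈ (powMonoidHom l : G →* G).range := by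
    rwa [range_eq_ker, MonoidHom.mem_ker]
  calc {z : G | z ^ l = powMonoidHom l y}.ncard
      = Nat.card (powMonoidHom l : G →* G).ker :=
        Nat.card_congr ((powMonoidHom l : G →* G).fiberEquivKer y)
    _ = l := by rw [IsCyclic.card_powMonoidHom_ker, hG, Nat.gcd_mul_right_left]

section FieldOfSquareOrder

variable {K : Type*} [Field K] [Finite K] {q : ℕ}

theorem two_le_of_natCard_eq_sq (hq : Nat.card K = q ^ 2) : 2 ≤ q := by
  have := Finite.one_lt_card (α := K)
  by_contra! h
  interval_cases q <;> omega

theorem add_pow_of_natCard_eq_sq (hq : Nat.card K = q ^ 2) (x y : K) :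
    (x + y) ^ q = x ^ q + y ^ q := by
  have := Fintype.ofFinite K
  obtain ⟨p, _, m, hp, hm⟩ := FiniteField.card' K
  have q_dvd : q ∣ p ^ (m : ℕ) := by
    rw [← hm, ← Nat.card_eq_fintype_card, hq]
    exact dvd_pow_self q two_ne_zero
  obtain ⟨s, -, rfl⟩ := (Nat.dvd_prime_pow hp).mp q_dvd
  have := Fact.mk hp
  exact add_pow_char_pow x y p s

/-- The nontrivial automorphism `x ↦ x ^ q` of a field with `q ^ 2` elements over its subfield with
`q` elements. -/
noncomputable def conjHom (hq : Nat.card K = q ^ 2) : K →+* K where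
  toFun x := x ^ q
  map_one' := one_pow q
  map_mul' x y := mul_pow x y q
  map_zero' := zero_pow (by have := two_le_of_natCard_eq_sq hq; omega)
  map_add' := add_pow_of_natCard_eq_sq hq

theorem conjHom_apply (hq : Nat.card K = q ^ 2) (x : K) : conjHom hq x = x ^ q := rfl

theorem conjHom_involutive (hq : Nat.card K = q ^ 2) : Function.Involutive (conjHom hq) := by
  have := Fintype.ofFinite K
  intro x
  rw [conjHom_apply, conjHom_apply, ← pow_mul, ← sq, ← hq, Nat.card_eq_fintype_card,
    FiniteField.pow_card]

theorem exists_add_conjHom_ne_zero (hq : Nat.card K = q ^ 2) : ∃ z, z + conjHom hq z ≠ 0 := by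
  have := Fintype.ofFinite K
  have h2 := two_le_of_natCard_eq_sq hq
  by_contra! h
  let P : Polynomial K := Polynomial.X + Polynomial.X ^ q
  have natDegree_P : P.natDegree = q := by
    rw [Polynomial.natDegree_add_eq_right_of_natDegree_lt] <;> simp
    omega
  have P_eq_zero : P = 0 :=
    P.eq_zero_of_natDegree_lt_card_of_eval_eq_zero' Finset.univ
      (fun x _ => by simpa [P, conjHom_apply] using h x) <| by
        rw [natDegree_P, Finset.card_univ, ← Nat.card_eq_fintype_card, hq]
        nlinarith
  rw [P_eq_zero, Polynomial.natDegree_zero] at natDegree_P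
  omega

theorem ncard_norm_fiber (hq : Nat.card K = q ^ 2) {a : K} (ha : a ≠ 0) (haq : a ^ q = a) :
    {t : K | t ^ (q + 1) = a}.ncard = q + 1 := by
  have h2 := two_le_of_natCard_eq_sq hq
  have card_units : Nat.card Kˣ = (q + 1) * (q - 1) := by
    rw [Nat.card_units, hq, ← Nat.sq_sub_sq, one_pow]
  have pow_eq_one : Units.mk0 a ha ^ (q - 1) = 1 := by
    refine Units.ext (mul_right_cancel₀ ha ?_)
    rw [Units.val_pow_eq_pow_val, Units.val_mk0, ← pow_succ, Nat.sub_add_cancel (by omega), haq,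
      Units.val_one, one_mul]
  have image_eq :
      Units.val '' {y : Kˣ | y ^ (q + 1) = Units.mk0 a ha} = {t | t ^ (q + 1) = a} := by
    ext t
    constructor
    · rintro ⟨y, hy, rfl⟩
      simpa using congrArg Units.val hy.out
    · intro ht
      have ht0 : t ≠ 0 := by
        rintro rfl
        exact ha (by rw [← ht.out, zero_pow q.succ_ne_zero])
      exact ⟨Units.mk0 t ht0, Units.ext ht, rfl⟩
  rw [← image_eq, Set.ncard_image_of_injective _ Units.val_injective,
    card_pow_fiber_of_card_eq_mul card_units pow_eq_one]

theorem exists_conjHom_mul_self_eq (hq : Nat.card K = q ^ 2) {a : K} (ha : a ≠ 0)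
    (haσ : conjHom hq a = a) : ∃ t, conjHom hq t * t = a := by
  obtain ⟨t, ht⟩ : {t : K | t ^ (q + 1) = a}.Nonempty :=
    Set.nonempty_of_ncard_ne_zero (by rw [ncard_norm_fiber hq ha haσ]; exact q.succ_ne_zero)
  exact ⟨t, by rw [conjHom_apply, ← pow_succ, ht.out]⟩

end FieldOfSquareOrder

section HermitianForm

open LinearMap (ker range)

variable {K V : Type*} [Field K] [AddCommGroup V] [Module K V] {σ : K →+* K}
  {B : V →ₛₗ[σ] V →ₗ[K] K}

/-- The trace condition `htrace` makes the polarization argument work in every characteristic. -/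
theorem apply_eq_zero_of_forall_mem_isotropic (hB : B.IsSymm) (htrace : ∃ c, c + σ c ≠ 0)
    {W : Submodule K V} (hW : ∀ w ∈ W, B w w = 0) {x y : V} (hx : x ∈ W) (hy : y ∈ W) :
    B x y = 0 := by
  by_contra hxy
  obtain ⟨c, hc⟩ := htrace
  let s := c / B x y
  have hs : s * B x y = c := div_mul_cancel₀ c hxy
  have expand : B (x + s • y) (x + s • y) = c + σ c := by
    simp only [map_add, LinearMap.add_apply, LinearMap.map_smulₛₗ, LinearMap.smul_apply, map_smul,
      smul_eq_mul, hW x hx, hW y hy, ← hB.eq x y, ← map_mul σ s, hs, mul_zero, zero_add, add_zero]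
    rw [add_comm]
  exact hc (expand ▸ hW _ (W.add_mem hx (W.smul_mem s hy)))

theorem mem_span_singleton_of_ker_le_ker (hB : B.SeparatingLeft) (hσ : Function.Surjective σ)
    {u v : V} (h : ker (B v) ≤ ker (B u)) : u ∈ K ∙ v := by
  obtain ⟨c, hc⟩ : ∃ c : K, c • B v = B u := by
    rw [← Submodule.mem_span_singleton, ← Set.range_const (ι := Unit)]
    exact mem_span_of_iInf_ker_le_ker (by simpa using h)
  obtain ⟨s, rfl⟩ := hσ c
  refine Submodule.mem_span_singleton.mpr ⟨s, sub_eq_zero.mp (hB _ fun y => ?_)⟩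
  rw [map_sub, LinearMap.map_smulₛₗ, hc, sub_self, LinearMap.zero_apply]

theorem exists_apply_eq_zero_and_apply_self_ne_zero [FiniteDimensional K V] (hB : B.IsSymm)
    (hBsep : B.SeparatingLeft) (hσ : Function.Surjective σ) (htrace : ∃ c, c + σ c ≠ 0)
    (hV : 3 ≤ Module.finrank K V) (v : V) : ∃ w, B v w = 0 ∧ B w w ≠ 0 := by
  by_contra! hiso
  have ker_le_span : ker (B v) ≤ K ∙ v := fun u hu =>
    mem_span_singleton_of_ker_le_ker hBsep hσ fun _ hw =>
      apply_eq_zero_of_forall_mem_isotropic hB htrace hiso hu hw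
  have ker_le_one := (Submodule.finrank_mono ker_le_span).trans (finrank_span_le_card {v})
  rw [Set.toFinset_singleton, Finset.card_singleton] at ker_le_one
  have range_le_one := (Submodule.finrank_le (range (B v))).trans_eq (Module.finrank_self K)
  have := (B v).finrank_range_add_finrank_ker
  omega

/-- Orthonormal families for a sesquilinear form over an arbitrary field. No positivity is
involved, so vectors orthogonal to the family may be isotropic. -/
structure IsOrthonormalFor (B : V →ₛₗ[σ] V →ₗ[K] K) {ι : Type*} (e : ι → V) : Prop where
  isOrthoᵢ : B.IsOrthoᵢ e
  apply_self : ∀ i, B (e i) (e i) = 1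

namespace IsOrthonormalFor

theorem linearIndependent {ι : Type*} {e : ι → V} (he : IsOrthonormalFor B e) :
    LinearIndependent K e :=
  LinearMap.linearIndependent_of_isOrthoᵢ he.isOrthoᵢ fun i => by
    simp [he.apply_self]

theorem cons (hB : B.IsSymm) {r : ℕ} {e : Fin r → V} (he : IsOrthonormalFor B e) {w : V}
    (hw : ∀ i, B (e i) w = 0) (hw1 : B w w = 1) : IsOrthonormalFor B (Fin.cons w e) where
  isOrthoᵢ := LinearMap.isOrthoᵢ_def.mpr <| Fin.cases
    (Fin.cases (fun h => absurd rfl h) fun j _ => by simpa using hB.eq_iff.mp (hw j))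
    fun i => Fin.cases (fun _ => by simpa using hw i) fun j hij => by
      simpa using he.isOrthoᵢ fun h => hij (congrArg Fin.succ h)
  apply_self := Fin.cases (by simpa using hw1) fun i => by simpa using he.apply_self i

theorem apply_sum_smul {ι : Type*} [Fintype ι] {e : ι → V} (he : IsOrthonormalFor B e)
    (c : ι → K) (i : ι) : B (e i) (∑ j, c j • e j) = c i := by
  simp only [map_sum, map_smul, smul_eq_mul]
  rw [Finset.sum_eq_single i fun j _ hij => by rw [he.isOrthoᵢ hij.symm, mul_zero]]
  · rw [he.apply_self, mul_one]
  · simp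

theorem exists_extension (hB : B.IsSymm) (hnorm : ∀ a, a ≠ 0 → σ a = a → ∃ t, σ t * t = a)
    {r : ℕ} {e : Fin r → V} (he : IsOrthonormalFor B e) {w : V} (hw : ∀ i, B (e i) w = 0)
    (hw0 : B w w ≠ 0) : ∃ e' : Fin (r + 1) → V, IsOrthonormalFor B e' := by
  obtain ⟨t, ht⟩ := hnorm (B w w)⁻¹ (inv_ne_zero hw0) (by rw [map_inv₀, hB.eq])
  refine ⟨_, he.cons hB (w := t • w) (fun i => by rw [map_smul, hw, smul_zero]) ?_⟩
  rw [LinearMap.map_smulₛₗ₂, map_smul, smul_eq_mul, smul_eq_mul, ← mul_assoc, ht,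
    inv_mul_cancel₀ hw0]

/-- Subtracting its orthogonal projections moves any vector into the complement of the family,
where the form vanishes by `apply_eq_zero_of_forall_mem_isotropic`. -/
theorem apply_eq_sum (hB : B.IsSymm) (htrace : ∃ c, c + σ c ≠ 0) {ι : Type*} [Fintype ι]
    {e : ι → V} (he : IsOrthonormalFor B e)
    (hiso : ∀ w, (∀ i, B (e i) w = 0) → B w w = 0) (x y : V) :
    B x y = ∑ i, σ (B (e i) x) * B (e i) y := by
  let proj (v : V) : V := ∑ i, B (e i) v • e i
  have ortho (v : V) (i : ι) : B (e i) (v - proj v) = 0 := by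
    rw [map_sub, he.apply_sum_smul, sub_self]
  have apply_proj (v w : V) : B (proj v) w = ∑ i, σ (B (e i) v) * B (e i) w := by
    simp [proj]
  have apply_sub : B (x - proj x) (y - proj y) = 0 := by
    let W : Submodule K V := ⨅ i, ker (B (e i))
    have mem_W (w : V) : w ∈ W ↔ ∀ i, B (e i) w = 0 := by simp [W]
    exact apply_eq_zero_of_forall_mem_isotropic hB htrace
      (fun w hw => hiso w ((mem_W w).mp hw)) ((mem_W _).mpr (ortho x)) ((mem_W _).mpr (ortho y))
  have apply_sub_proj : B (x - proj x) (proj y) = 0 := by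
    rw [hB.eq_iff, apply_proj]
    simp only [ortho, mul_zero, Finset.sum_const_zero]
  calc B x y = B (proj x) y + (B (x - proj x) (proj y) + B (x - proj x) (y - proj y)) := by
        rw [← map_add (B (x - proj x)), add_sub_cancel, ← LinearMap.add_apply, ← map_add B,
          add_sub_cancel]
    _ = ∑ i, σ (B (e i) x) * B (e i) y := by
        rw [apply_sub, apply_sub_proj, add_zero, add_zero, apply_proj]

end IsOrthonormalFor

theorem exists_surjective_apply_eq_sum [FiniteDimensional K V] (hB : B.IsSymm)
    (htrace : ∃ c, c + σ c ≠ 0) (hnorm : ∀ a, a ≠ 0 → σ a = a → ∃ t, σ t * t = a) :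
    ∃ (r : ℕ) (f : V →ₗ[K] Fin r → K), Function.Surjective f ∧
      ∀ x y, B x y = ∑ i, σ (f x i) * f y i := by
  obtain ⟨r, e, he, hiso⟩ : ∃ (r : ℕ) (e : Fin r → V), IsOrthonormalFor B e ∧
      ∀ w, (∀ i, B (e i) w = 0) → B w w = 0 := by
    by_contra! hext
    have exists_family (r : ℕ) : ∃ e : Fin r → V, IsOrthonormalFor B e := by
      induction r with
      | zero => exact ⟨Fin.elim0, fun i => i.elim0, fun i => i.elim0⟩
      | succ r ih =>
        obtain ⟨e, he⟩ := ih
        obtain ⟨w, hw, hw0⟩ := hext r e he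
        exact he.exists_extension hB hnorm hw hw0
    obtain ⟨e, he⟩ := exists_family (Module.finrank K V + 1)
    simpa using he.linearIndependent.fintype_card_le_finrank
  refine ⟨r, LinearMap.pi fun i => B (e i), fun c => ⟨∑ j, c j • e j, ?_⟩,
    he.apply_eq_sum hB htrace hiso⟩
  ext i
  exact he.apply_sum_smul c i

theorem ker_eq_ker_flip_of_apply_eq_sum {ι : Type*} [Fintype ι] {f : V →ₗ[K] ι → K}
    (hf : Function.Surjective f) (hB : ∀ x y, B x y = ∑ i, σ (f x i) * f y i) :
    ker f = ker B.flip := by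
  classical
  ext y
  simp only [LinearMap.mem_ker, LinearMap.ext_iff, LinearMap.flip_apply, LinearMap.zero_apply, hB]
  refine ⟨fun h x => by simp [h], fun h => funext fun i => ?_⟩
  obtain ⟨x, hx⟩ := hf (Pi.single i 1)
  simpa [hx, Pi.single_apply, apply_ite σ] using h x

end HermitianForm

section HermitianMatrix

open LinearMap (ker)

variable {K ι : Type*} [Field K] [Finite K] [Fintype ι] [DecidableEq ι] {q : ℕ}

/-- The sesquilinear form `(x, y) ↦ ∑ i, ∑ j, x i ^ q * y j * H j i` of a matrix. The transpose
moves the conjugation of `hermitianPoly` to the first argument. -/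
noncomputable def hermitianForm (hq : Nat.card K = q ^ 2) (H : Matrix ι ι K) :
    (ι → K) →ₛₗ[conjHom hq] (ι → K) →ₗ[K] K :=
  Matrix.toLinearMapₛₗ₂' K (conjHom hq) (RingHom.id K) H.transpose

theorem hermitianForm_apply (hq : Nat.card K = q ^ 2) (H : Matrix ι ι K) (x y : ι → K) :
    hermitianForm hq H x y = ∑ i, x i ^ q * (H.transpose *ᵥ y) i := by
  simp only [hermitianForm, Matrix.toLinearMapₛₗ₂'_apply, conjHom_apply, RingHom.id_apply,
    smul_eq_mul, Matrix.mulVec, dotProduct, Finset.mul_sum]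
  exact Finset.sum_congr rfl fun i _ => Finset.sum_congr rfl fun j _ => by ring

theorem hermitianForm_apply_self (hq : Nat.card K = q ^ 2) (H : Matrix ι ι K) (x : ι → K) :
    hermitianForm hq H x x = eval x (hermitianPoly q H) := by
  simp only [hermitianForm_apply, hermitianPoly, map_sum, map_mul, map_pow, eval_C, eval_X,
    Matrix.mulVec, dotProduct, Finset.mul_sum, Matrix.transpose_apply]
  rw [Finset.sum_comm]
  exact Finset.sum_congr rfl fun i _ => Finset.sum_congr rfl fun j _ => by ring

theorem hermitianForm_isSymm (hq : Nat.card K = q ^ 2) {H : Matrix ι ι K}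
    (hH : IsHermitianMatrix q H) : (hermitianForm hq H).IsSymm where
  eq x y := by
    have conj_H (i j : ι) : conjHom hq (H j i) = H i j :=
      (congrFun (congrFun hH.2 j) i).symm
    simp only [hermitianForm_apply, ← conjHom_apply hq, map_sum, map_mul, conjHom_involutive hq _,
      Matrix.mulVec, dotProduct, Finset.mul_sum, Matrix.transpose_apply, conj_H]
    rw [Finset.sum_comm]
    exact Finset.sum_congr rfl fun i _ => Finset.sum_congr rfl fun j _ => by ring

theorem ker_flip_hermitianForm (hq : Nat.card K = q ^ 2) (H : Matrix ι ι K) :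
    ker (hermitianForm hq H).flip = ker H.transpose.mulVecLin := by
  ext y
  simp only [LinearMap.mem_ker, LinearMap.ext_iff, LinearMap.flip_apply, LinearMap.zero_apply,
    hermitianForm_apply, Matrix.mulVecLin_apply]
  refine ⟨fun h => funext fun i => ?_, fun h x => by simp [h]⟩
  have h2 := two_le_of_natCard_eq_sq hq
  simpa [Pi.single_apply, ite_pow, zero_pow (show q ≠ 0 by omega)] using h (Pi.single i 1)

theorem finrank_ker_flip_hermitianForm (hq : Nat.card K = q ^ 2) (H : Matrix ι ι K) :
    H.rank + Module.finrank K (ker (hermitianForm hq H).flip) = Fintype.card ι := by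
  rw [ker_flip_hermitianForm, ← Matrix.rank_transpose, Matrix.rank,
    LinearMap.finrank_range_add_finrank_ker, Module.finrank_fintype_fun_eq_card]

theorem hermitianForm_separatingLeft (hq : Nat.card K = q ^ 2) {H : Matrix ι ι K}
    (hH : IsHermitianMatrix q H) (hr : H.rank = Fintype.card ι) :
    (hermitianForm hq H).SeparatingLeft := by
  intro x hx
  have hfinrank := finrank_ker_flip_hermitianForm hq H
  rw [hr, Nat.add_eq_left, Submodule.finrank_eq_zero] at hfinrank
  rw [← Submodule.mem_bot K, ← hfinrank, LinearMap.mem_ker]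
  ext1 y
  exact (hermitianForm_isSymm hq hH).eq_iff.mp (hx y)

end HermitianMatrix

theorem exists_surjective_eval_hermitianPoly_eq_sum {K ι : Type*} [Field K] [Finite K] [Fintype ι]
    {q : ℕ} (hq : Nat.card K = q ^ 2) {H : Matrix ι ι K} (hH : IsHermitianMatrix q H) {r : ℕ}
    (hr : H.rank = r) : ∃ f : (ι → K) →ₗ[K] Fin r → K, Function.Surjective f ∧
      ∀ x, eval x (hermitianPoly q H) = ∑ i, f x i ^ (q + 1) := by
  classical
  obtain ⟨s, f, hf, hfB⟩ := exists_surjective_apply_eq_sum (hermitianForm_isSymm hq hH)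
    (exists_add_conjHom_ne_zero hq) fun a => exists_conjHom_mul_self_eq hq
  obtain rfl : s = r := by
    have hrank := finrank_ker_flip_hermitianForm hq H
    rw [hr, ← ker_eq_ker_flip_of_apply_eq_sum hf hfB] at hrank
    have hrange := f.finrank_range_add_finrank_ker
    rw [LinearMap.range_eq_top.mpr hf, finrank_top, Module.finrank_fin_fun,
      Module.finrank_fintype_fun_eq_card] at hrange
    omega
  exact ⟨f, hf, fun x => by
    simp only [← hermitianForm_apply_self hq, hfB, conjHom_apply, ← pow_succ]⟩

section Counting

theorem ncard_affine_cone {K V : Type*} [Field K] [AddCommGroup V] [Module K V] [Finite V]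
    {C : Set V} {S : Set (ℙ K V)} (hC : 0 ∈ C)
    (hS : ∀ v hv, Projectivization.mk K v hv ∈ S ↔ v ∈ C) :
    C.ncard = 1 + (Nat.card K - 1) * S.ncard := by
  let e := Projectivization.nonZeroEquivProjectivizationProdUnits K V
  have image_eq : Subtype.val '' (e ⁻¹' (S ×ˢ Set.univ)) = C \ {0} := by
    ext v
    constructor
    · rintro ⟨⟨v, hv⟩, hvS, rfl⟩
      exact ⟨(hS v hv).mp hvS.1, hv⟩
    · rintro ⟨hvC, hv⟩
      exact ⟨⟨v, hv⟩, ⟨(hS v hv).mpr hvC, trivial⟩, rfl⟩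
  rw [← Set.ncard_sdiff_singleton_add_one hC, ← image_eq,
    Set.ncard_image_of_injective _ Subtype.val_injective,
    Set.ncard_preimage_of_injective_subset_range e.injective (by simp), Set.ncard_prod,
    Set.ncard_univ, Nat.card_units, add_comm, mul_comm]

theorem card_mul_ncard_le_of_forall_ncard_translate_le {E V : Type*} [Finite E] [AddGroup V]
    [Finite V] (f : E → V) {Z : Set V} {c : ℕ} (hc : ∀ u, {e | u + f e ∈ Z}.ncard ≤ c) :
    Nat.card E * Z.ncard ≤ Nat.card V * c := by
  have := Fintype.ofFinite E
  have := Fintype.ofFinite V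
  classical
  have ncard_translate (e : E) : {u | u + f e ∈ Z}.ncard = Z.ncard :=
    Set.ncard_preimage_of_injective_subset_range (Equiv.addRight (f e)).injective
      ((Equiv.addRight (f e)).range_eq_univ ▸ Z.subset_univ)
  calc Nat.card E * Z.ncard
      = ∑ e : E, (Finset.univ.filter fun u => u + f e ∈ Z).card := by
        simp only [← Set.ncard_coe_finset, Finset.coe_filter_univ, ncard_translate,
          Finset.sum_const, Finset.coe_univ, Set.ncard_univ, smul_eq_mul]
    _ = ∑ u : V, (Finset.univ.filter fun e => u + f e ∈ Z).card :=
        Finset.sum_card_bipartiteAbove_eq_sum_card_bipartiteBelow _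
    _ ≤ ∑ _u : V, c := Finset.sum_le_sum fun u _ => by
        rw [← Set.ncard_coe_finset, Finset.coe_filter_univ]
        exact hc u
    _ = Nat.card V * c := by
        rw [Finset.sum_const, Finset.card_univ, smul_eq_mul, Nat.card_eq_fintype_card]

theorem ncard_eq_sum_ncard_cons {α : Type*} [Fintype α] {m : ℕ} (Z : Set (Fin (m + 1) → α)) :
    Z.ncard = ∑ x : Fin m → α, {t | (Fin.cons t x : Fin (m + 1) → α) ∈ Z}.ncard := by
  let e : (Σ x : Fin m → α, {t | (Fin.cons t x : Fin (m + 1) → α) ∈ Z}) ≃ Z :=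
    { toFun := fun y => ⟨Fin.cons y.2.1 y.1, y.2.2⟩
      invFun := fun y => ⟨Fin.tail y.1, y.1 0, by simp [Fin.cons_self_tail]⟩
      left_inv := fun _ => rfl
      right_inv := fun y => Subtype.ext (Fin.cons_self_tail y.1) }
  rw [← Nat.card_coe_set_eq, ← Nat.card_congr e, Nat.card_sigma]
  rfl

end Counting

section DiagonalHermitian

variable {K : Type*} [Field K] [Finite K] {q : ℕ}

theorem ncard_sum_pow_zeros_succ (hq : Nat.card K = q ^ 2) (m : ℕ) :
    {x : Fin (m + 1) → K | ∑ i, x i ^ (q + 1) = 0}.ncard +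
      q * {x : Fin m → K | ∑ i, x i ^ (q + 1) = 0}.ncard = (q + 1) * q ^ (2 * m) := by
  classical
  have := Fintype.ofFinite K
  have ncard_fiber (x : Fin m → K) :
      {t : K | t ^ (q + 1) + ∑ i, x i ^ (q + 1) = 0}.ncard +
        (if ∑ i, x i ^ (q + 1) = 0 then q else 0) = q + 1 := by
    split_ifs with hx
    · have fiber_eq : {t : K | t ^ (q + 1) + ∑ i, x i ^ (q + 1) = 0} = {0} := by
        ext t
        simp [hx]
      rw [fiber_eq, Set.ncard_singleton, add_comm]
    · have conj_fixed : (-∑ i, x i ^ (q + 1)) ^ q = -∑ i, x i ^ (q + 1) := by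
        rw [← conjHom_apply hq, map_neg, map_sum]
        simp only [pow_succ, ← conjHom_apply hq, map_mul, conjHom_involutive hq _, mul_comm]
      simp only [← eq_neg_iff_add_eq_zero, ncard_norm_fiber hq (neg_ne_zero.mpr hx) conj_fixed,
        add_zero]
  calc _ = ∑ x : Fin m → K, ({t : K | t ^ (q + 1) + ∑ i, x i ^ (q + 1) = 0}.ncard +
          if ∑ i, x i ^ (q + 1) = 0 then q else 0) := by
        rw [ncard_eq_sum_ncard_cons, Finset.sum_add_distrib, ← Finset.sum_filter,
          Finset.sum_const, smul_eq_mul, ← Set.ncard_coe_finset, Finset.coe_filter_univ, mul_comm q]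
        simp only [Set.mem_ofPred_eq, Fin.sum_univ_succ, Fin.cons_zero, Fin.cons_succ]
    _ = (q + 1) * q ^ (2 * m) := by
        rw [Finset.sum_congr rfl fun x _ => ncard_fiber x, Finset.sum_const, Finset.card_univ,
          ← Nat.card_eq_fintype_card, Nat.card_fun, Nat.card_fin, hq, ← pow_mul, smul_eq_mul,
          mul_comm]

theorem ncard_sum_pow_zeros_add_le (hq : Nat.card K = q ^ 2) (m : ℕ) :
    {x : Fin (m + 3) → K | ∑ i, x i ^ (q + 1) = 0}.ncard + (q + 1) * q ^ (2 * m + 2) ≤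
      (q + 1) * q ^ (2 * m + 4) := by
  let N (l : ℕ) : ℕ := {x : Fin l → K | ∑ i, x i ^ (q + 1) = 0}.ncard
  have hN (l : ℕ) : N (l + 1) + q * N l = (q + 1) * q ^ (2 * l) := ncard_sum_pow_zeros_succ hq l
  have upper : N (m + 1) ≤ (q + 1) * q ^ (2 * m) := hN m ▸ Nat.le_add_right _ _
  have lower : (q + 1) * q ^ (2 * m + 2) ≤ q * N (m + 2) := by
    have h2 := two_le_of_natCard_eq_sq hq
    refine le_of_add_le_add_right (a := q * (q * N (m + 1))) ?_
    calc (q + 1) * q ^ (2 * m + 2) + q * (q * N (m + 1))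
        ≤ (q + 1) * q ^ (2 * m + 2) + q * (q * ((q + 1) * q ^ (2 * m))) := by gcongr
      _ = 2 * ((q + 1) * q ^ (2 * m + 2)) := by ring
      _ ≤ q * ((q + 1) * q ^ (2 * m + 2)) := by gcongr
      _ = q * N (m + 2) + q * (q * N (m + 1)) := by rw [← mul_add, hN]; ring
  calc N (m + 3) + (q + 1) * q ^ (2 * m + 2) ≤ N (m + 3) + q * N (m + 2) := by gcongr
    _ = (q + 1) * q ^ (2 * m + 4) := hN (m + 2)

theorem ncard_hermitianPoly_zeros_add_le (hq : Nat.card K = q ^ 2) {m : ℕ}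
    {U : Matrix (Fin (m + 3)) (Fin (m + 3)) K} (hU : IsHermitianMatrix q U)
    (hUr : U.rank = m + 3) :
    {x | eval x (hermitianPoly q U) = 0}.ncard + (q + 1) * q ^ (2 * m + 2) ≤
      (q + 1) * q ^ (2 * m + 4) := by
  obtain ⟨f, f_surjective, hf⟩ := exists_surjective_eval_hermitianPoly_eq_sum hq hU hUr
  have f_injective := LinearMap.injective_iff_surjective.mpr f_surjective
  have preimage_eq : {x | eval x (hermitianPoly q U) = 0} =
      f ⁻¹' {x | ∑ i, x i ^ (q + 1) = 0} := by
    ext x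
    rw [Set.mem_ofPred_eq, hf, Set.mem_preimage, Set.mem_ofPred_eq]
  rw [preimage_eq, Set.ncard_preimage_of_injective_subset_range f_injective]
  · exact ncard_sum_pow_zeros_add_le hq m
  · rw [f_surjective.range_eq]
    exact Set.subset_univ _

end DiagonalHermitian

section HermitianIntersection

theorem eval_eq_zero_of_totalDegree_lt_ncard {K ι : Type*} [Field K] {G : MvPolynomial ι K}
    {v w : ι → K} {T : Set K} (hT : G.totalDegree < T.ncard)
    (h : ∀ t ∈ T, eval (v + t • w) G = 0) : eval v G = 0 := by
  let P : Polynomial K := aeval (fun i => Polynomial.C (v i) + Polynomial.C (w i) * Polynomial.X) G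
  have eval_P (t : K) : P.eval t = eval (v + t • w) G := by
    rw [← Polynomial.coe_aeval_eq_eval, ← coe_aeval_eq_eval, RingHom.coe_coe, comp_aeval_apply]
    congr 2
    ext i
    simp only [map_add, map_mul, Polynomial.aeval_C, Polynomial.aeval_X, Pi.add_apply,
      Pi.smul_apply, smul_eq_mul, Algebra.algebraMap_self, RingHom.id_apply, mul_comm]
  have natDegree_P : P.natDegree ≤ G.totalDegree := by
    refine (aeval_natDegree_le G le_rfl _ fun i => ?_).trans_eq (mul_one _)
    compute_degree
  have T_finite : T.Finite := Set.finite_of_ncard_pos (Nat.zero_lt_of_lt hT)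
  have P_eq_zero : P = 0 := by
    refine P.eq_zero_of_natDegree_lt_card_of_eval_eq_zero' T_finite.toFinset (fun t ht => ?_) ?_
    · rw [eval_P, h t (T_finite.mem_toFinset.mp ht)]
    · rw [← Set.ncard_eq_toFinset_card T T_finite]
      exact natDegree_P.trans_lt hT
  simpa [P_eq_zero] using (eval_P 0).symm

variable {K ι : Type*} [Field K] [Finite K] [Fintype ι] [DecidableEq ι] {q : ℕ}

theorem exists_hermitianForm_apply_eq_zero_and_apply_self_ne_zero (hq : Nat.card K = q ^ 2)
    {U : Matrix ι ι K} (hU : IsHermitianMatrix q U) (hUr : U.rank = Fintype.card ι)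
    (hι : 3 ≤ Fintype.card ι) (v : ι → K) :
    ∃ w, hermitianForm hq U v w = 0 ∧ hermitianForm hq U w w ≠ 0 :=
  exists_apply_eq_zero_and_apply_self_ne_zero (hermitianForm_isSymm hq hU)
    (hermitianForm_separatingLeft hq hU hUr) (conjHom_involutive hq).surjective
    (exists_add_conjHom_ne_zero hq) (by rwa [Module.finrank_fintype_fun_eq_card]) v

theorem hermitianForm_apply_add_smul (hq : Nat.card K = q ^ 2) (U : Matrix ι ι K)
    {v w : ι → K} (hvw : hermitianForm hq U v w = 0) (hwv : hermitianForm hq U w v = 0) (t : K) :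
    hermitianForm hq U (v + t • w) (v + t • w) =
      hermitianForm hq U v v + t ^ (q + 1) * hermitianForm hq U w w := by
  simp only [map_add, LinearMap.add_apply, LinearMap.map_smulₛₗ, LinearMap.smul_apply, map_smul,
    smul_eq_mul, conjHom_apply, hvw, hwv]
  ring

/-- Through a vector `v` that is not isotropic goes a line `v + t • w` with `q + 1` isotropic
points, too many for a polynomial of degree at most `q` that does not vanish at `v`. -/
theorem exists_isotropic_eval_ne_zero (hq : Nat.card K = q ^ 2) {U : Matrix ι ι K}
    (hU : IsHermitianMatrix q U) (hUr : U.rank = Fintype.card ι) (hι : 3 ≤ Fintype.card ι)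
    {G : MvPolynomial ι K} {k : ℕ} (hG : G.IsHomogeneous k) (hG0 : G ≠ 0) (hk : k ≤ q) :
    ∃ p, hermitianForm hq U p p = 0 ∧ eval p G ≠ 0 := by
  by_contra! hvanish
  have hsymm := hermitianForm_isSymm hq hU
  refine hG0 (hG.eq_zero_of_forall_eval_eq_zero_of_le_card (fun v => ?_) ?_)
  · by_cases hv : hermitianForm hq U v v = 0
    · exact hvanish v hv
    obtain ⟨w, hvw, hw⟩ :=
      exists_hermitianForm_apply_eq_zero_and_apply_self_ne_zero hq hU hUr hι v
    let a := -hermitianForm hq U v v / hermitianForm hq U w w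
    have conj_a : a ^ q = a := by
      rw [← conjHom_apply hq, map_div₀, map_neg, hsymm.eq, hsymm.eq]
    refine eval_eq_zero_of_totalDegree_lt_ncard (w := w) (T := {t | t ^ (q + 1) = a}) ?_
      fun t ht => hvanish _ ?_
    · rw [ncard_norm_fiber hq (div_ne_zero (neg_ne_zero.mpr hv) hw) conj_a]
      exact Nat.lt_succ_of_le (hG.totalDegree_le.trans hk)
    · rw [hermitianForm_apply_add_smul hq U hvw (hsymm.eq_iff.mp hvw), ht.out,
        div_mul_cancel₀ _ hw, add_neg_cancel]
  · rw [← Nat.cast_card, hq]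
    exact_mod_cast hk.trans (Nat.le_self_pow two_ne_zero q)

/-- The two cross terms of degree `q + 1` vanish because `p` and `v` are orthogonal. -/
theorem exists_eval_hermitianPoly_plane_eq (hq : Nat.card K = q ^ 2) {U : Matrix ι ι K}
    (hU : IsHermitianMatrix q U) (u : ι → K) {p v : ι → K} (hp : hermitianForm hq U p p = 0)
    (hpv : hermitianForm hq U p v = 0) :
    ∃ r : MvPolynomial (Fin 2) K, r.totalDegree < q + 1 ∧ ∀ z : Fin 2 → K,
      eval (u + z 0 • p + z 1 • v) (hermitianPoly q U) =
        eval z (C (hermitianForm hq U v v) * X 1 ^ (q + 1) + r) := by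
  have hvp := (hermitianForm_isSymm hq hU).eq_iff.mp hpv
  have h2 := two_le_of_natCard_eq_sq hq
  let B := hermitianForm hq U
  have totalDegree_term (c : K) (i : Fin 2) {j : ℕ} (hj : j ≤ q) :
      (C c * X i ^ j).totalDegree ≤ q := by
    rw [C_mul_X_pow_eq_monomial]
    exact (totalDegree_monomial_le _ c).trans (by simpa using hj)
  refine ⟨C (B u u) * X 0 ^ 0 + C (B u p) * X 0 ^ 1 + C (B p u) * X 0 ^ q + C (B u v) * X 1 ^ 1 +
    C (B v u) * X 1 ^ q, Nat.lt_succ_of_le ?_, fun z => ?_⟩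
  · iterate 4 refine (totalDegree_add _ _).trans (max_le ?_ (totalDegree_term _ _ (by omega)))
    exact totalDegree_term _ _ (Nat.zero_le q)
  · simp only [← hermitianForm_apply_self hq, map_add, LinearMap.add_apply, LinearMap.map_smulₛₗ,
      LinearMap.smul_apply, map_smul, smul_eq_mul, conjHom_apply, hp, hpv, hvp, map_mul, map_pow,
      eval_C, eval_X, B]
    ring

end HermitianIntersection

theorem ncard_hermitianPoly_inter_zeros_mul_le {K ι : Type*} [Field K] [Finite K] [Fintype ι]
    {q : ℕ} (hq : Nat.card K = q ^ 2) {U : Matrix ι ι K} (hU : IsHermitianMatrix q U)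
    (hUr : U.rank = Fintype.card ι) (hι : 3 ≤ Fintype.card ι) {G : MvPolynomial ι K} {k : ℕ}
    (hG : G.IsHomogeneous k) (hG0 : G ≠ 0) (hk : k ≤ q) :
    q ^ 4 * {x | eval x (hermitianPoly q U) = 0 ∧ eval x G = 0}.ncard ≤
      q ^ (2 * Fintype.card ι) * (k * (q + 1)) := by
  classical
  obtain ⟨p, hp, hGp⟩ := exists_isotropic_eval_ne_zero hq hU hUr hι hG hG0 hk
  obtain ⟨v, hpv, hv⟩ := exists_hermitianForm_apply_eq_zero_and_apply_self_ne_zero hq hU hUr hι p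
  have ncard_plane (u : ι → K) :
      {z : Fin 2 → K | u + (z 0 • p + z 1 • v) ∈
        {x | eval x (hermitianPoly q U) = 0 ∧ eval x G = 0}}.ncard ≤ k * (q + 1) := by
    obtain ⟨r, hr, eval_eq⟩ := exists_eval_hermitianPoly_plane_eq hq hU u hp hpv
    simpa only [Set.mem_ofPred_eq, ← add_assoc, eval_eq, and_comm] using
      ncard_plane_zeros_le hG u v hGp hv hr
  simpa only [Nat.card_fun, Nat.card_fin, Nat.card_eq_fintype_card (α := ι), hq, ← pow_mul] using
    card_mul_ncard_le_of_forall_ncard_translate_le _ ncard_plane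

theorem exists_linearEquiv_apply_eq_tail {K : Type*} [Field K] {n : ℕ}
    {f : (Fin (n + 1) → K) →ₗ[K] Fin n → K} (hf : Function.Surjective f) :
    ∃ Φ : (Fin (n + 1) → K) ≃ₗ[K] (Fin (n + 1) → K), ∀ y, f (Φ y) = Fin.tail y := by
  obtain ⟨s, hs⟩ := f.exists_rightInverse_of_surjective (LinearMap.range_eq_top.mpr hf)
  obtain ⟨e, he, he0⟩ := (Submodule.ne_bot_iff _).mp
    (LinearMap.ker_ne_bot_of_finrank_lt (f := f) (by simp))
  let T := (LinearMap.proj 0).smulRight e + s ∘ₗ LinearMap.funLeft K K Fin.succ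
  have T_apply (y : Fin (n + 1) → K) : T y = y 0 • e + s (Fin.tail y) := rfl
  have f_T (y : Fin (n + 1) → K) : f (T y) = Fin.tail y := by
    rw [T_apply, map_add, map_smul, LinearMap.mem_ker.mp he, smul_zero, zero_add]
    exact LinearMap.congr_fun hs _
  have T_injective : Function.Injective T := by
    refine LinearMap.ker_eq_bot.mp (LinearMap.ker_eq_bot'.mpr fun y hy => ?_)
    have tail_eq_zero : Fin.tail y = 0 := by rw [← f_T, hy, map_zero]
    rw [T_apply, tail_eq_zero, map_zero, add_zero, smul_eq_zero, or_iff_left he0] at hy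
    exact funext (Fin.cases hy (congrFun tail_eq_zero))
  exact ⟨LinearEquiv.ofInjectiveEndo T T_injective, f_T⟩

theorem exists_linearEquiv_eval_hermitianPoly_eq {K : Type*} [Field K] [Finite K] {q n : ℕ}
    (hq : Nat.card K = q ^ 2) {H : Matrix (Fin (n + 1)) (Fin (n + 1)) K}
    (hH : IsHermitianMatrix q H) (hHr : H.rank = n) {U : Matrix (Fin n) (Fin n) K}
    (hU : IsHermitianMatrix q U) (hUr : U.rank = n) :
    ∃ Φ : (Fin (n + 1) → K) ≃ₗ[K] (Fin (n + 1) → K), ∀ y,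
      eval (Φ y) (hermitianPoly q H) = eval (Fin.tail y) (hermitianPoly q U) := by
  obtain ⟨fH, fH_surjective, hfH⟩ := exists_surjective_eval_hermitianPoly_eq_sum hq hH hHr
  obtain ⟨fU, fU_surjective, hfU⟩ := exists_surjective_eval_hermitianPoly_eq_sum hq hU hUr
  let gU := LinearEquiv.ofBijective fU
    ⟨LinearMap.injective_iff_surjective.mpr fU_surjective, fU_surjective⟩
  obtain ⟨Φ, hΦ⟩ := exists_linearEquiv_apply_eq_tail
    (f := (gU.symm : (Fin n → K) →ₗ[K] Fin n → K) ∘ₗ fH) (gU.symm.surjective.comp fH_surjective)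
  refine ⟨Φ, fun y => ?_⟩
  have fH_eq : fH (Φ y) = fU (Fin.tail y) := gU.symm_apply_eq.mp (hΦ y)
  rw [hfH, hfU, fH_eq]

section VertexCoordinate

variable {K : Type*} [Field K] {n d : ℕ}

theorem exists_isHomogeneous_eval_eq_eval_apply {ι κ : Type*} [Finite ι]
    (f : (ι → K) →ₗ[K] κ → K) {F : MvPolynomial κ K} (hF : F.IsHomogeneous d) :
    ∃ F' : MvPolynomial ι K, F'.IsHomogeneous d ∧ ∀ y, eval y F' = eval (f y) F := by
  classical
  have := Fintype.ofFinite ι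
  let A := LinearMap.toMatrix' f
  refine ⟨aeval A.toMvPolynomial F, ?_, fun y => ?_⟩
  · simpa only [one_mul] using hF.aeval _ fun i => A.toMvPolynomial_isHomogeneous i
  · rw [eval_aeval]
    simp only [A, Matrix.toMvPolynomial_eval_eq_apply, ← Matrix.toLin'_apply,
      Matrix.toLin'_toMatrix']

theorem ncard_fiber_eval_cons_le {F : MvPolynomial (Fin (n + 1)) K} {x : Fin n → K}
    (hx : eval x (finSuccEquiv K n F).leadingCoeff ≠ 0) :
    {t | eval (Fin.cons t x : Fin (n + 1) → K) F = 0}.ncard ≤ (finSuccEquiv K n F).natDegree := by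
  let P := (finSuccEquiv K n F).map (eval x)
  have P_ne_zero : P ≠ 0 := fun hP => hx <| by
    rw [← Polynomial.coeff_natDegree, ← Polynomial.coeff_map]
    exact congrArg (Polynomial.coeff · _) hP
  calc {t | eval (Fin.cons t x : Fin (n + 1) → K) F = 0}.ncard
      = (P.rootSet K).ncard := by
        congr 1
        ext t
        rw [Set.mem_ofPred_eq, eval_eq_eval_mv_eval', Polynomial.mem_rootSet_of_ne P_ne_zero,
          Polynomial.coe_aeval_eq_eval]
    _ ≤ P.natDegree := P.ncard_rootSet_le K
    _ ≤ (finSuccEquiv K n F).natDegree := Polynomial.natDegree_map_le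

variable [Finite K]

theorem ncard_tail_mem_and_eval_eq_zero_le (F : MvPolynomial (Fin (n + 1)) K)
    (S : Set (Fin n → K)) :
    {y | (Fin.tail y : Fin n → K) ∈ S ∧ eval y F = 0}.ncard ≤
      (finSuccEquiv K n F).natDegree *
          {x | x ∈ S ∧ eval x (finSuccEquiv K n F).leadingCoeff ≠ 0}.ncard +
        Nat.card K * {x | x ∈ S ∧ eval x (finSuccEquiv K n F).leadingCoeff = 0}.ncard := by
  classical
  have := Fintype.ofFinite K
  let e := (finSuccEquiv K n F).natDegree
  let G := (finSuccEquiv K n F).leadingCoeff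
  have ncard_fiber_le (x : Fin n → K) :
      {t | x ∈ S ∧ eval (Fin.cons t x : Fin (n + 1) → K) F = 0}.ncard ≤
        (if x ∈ S ∧ eval x G ≠ 0 then e else 0) +
          if x ∈ S ∧ eval x G = 0 then Nat.card K else 0 := by
    by_cases hxS : x ∈ S
    · by_cases hxG : eval x G = 0
      · simpa only [hxS, hxG, true_and, ne_eq, not_true, if_true, if_false, zero_add] using
          Set.ncard_le_card _
      · simpa [hxS, hxG] using ncard_fiber_eval_cons_le hxG
    · simp [hxS]
  rw [ncard_eq_sum_ncard_cons]
  refine (Finset.sum_le_sum fun x _ => ncard_fiber_le x).trans_eq ?_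
  rw [Finset.sum_add_distrib, ← Finset.sum_filter, ← Finset.sum_filter, Finset.sum_const,
    Finset.sum_const, smul_eq_mul, smul_eq_mul, ← Set.ncard_coe_finset, ← Set.ncard_coe_finset,
    Finset.coe_filter_univ, Finset.coe_filter_univ, mul_comm, mul_comm (Nat.card K)]

theorem exists_leadingForm_ncard_le {F : MvPolynomial (Fin (n + 1)) K} (hF : F.IsHomogeneous d)
    (hF0 : F ≠ 0) (S : Set (Fin n → K)) :
    ∃ e ≤ d, ∃ G : MvPolynomial (Fin n) K, G.IsHomogeneous (d - e) ∧ G ≠ 0 ∧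
      {y | (Fin.tail y : Fin n → K) ∈ S ∧ eval y F = 0}.ncard ≤
        e * {x | x ∈ S ∧ eval x G ≠ 0}.ncard + Nat.card K * {x | x ∈ S ∧ eval x G = 0}.ncard := by
  have natDegree_le : (finSuccEquiv K n F).natDegree ≤ d := by
    rw [natDegree_finSuccEquiv]
    exact (degreeOf_le_totalDegree F 0).trans hF.totalDegree_le
  exact ⟨_, natDegree_le, (finSuccEquiv K n F).leadingCoeff,
    hF.finSuccEquiv_coeff_isHomogeneous _ _ (Nat.add_sub_of_le natDegree_le),
    Polynomial.leadingCoeff_ne_zero.mpr ((map_ne_zero_iff _ (finSuccEquiv K n).injective).mpr hF0),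
    ncard_tail_mem_and_eval_eq_zero_le F S⟩

theorem exists_leadingForm_ncard_le_of_linearEquiv {F : MvPolynomial (Fin (n + 1)) K}
    (hF : F.IsHomogeneous d) (hF0 : F ≠ 0) (hd : d ≤ Nat.card K)
    (Φ : (Fin (n + 1) → K) ≃ₗ[K] (Fin (n + 1) → K)) {X : Set (Fin (n + 1) → K)}
    {S : Set (Fin n → K)} (hX : ∀ y, Φ y ∈ X ↔ (Fin.tail y : Fin n → K) ∈ S) :
    ∃ e ≤ d, ∃ G : MvPolynomial (Fin n) K, G.IsHomogeneous (d - e) ∧ G ≠ 0 ∧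
      {x | x ∈ X ∧ eval x F = 0}.ncard ≤
        e * {x | x ∈ S ∧ eval x G ≠ 0}.ncard + Nat.card K * {x | x ∈ S ∧ eval x G = 0}.ncard := by
  obtain ⟨F', hF', eval_F'⟩ := exists_isHomogeneous_eval_eq_eval_apply Φ.toLinearMap hF
  have F'_ne_zero : F' ≠ 0 := by
    rintro rfl
    refine hF0 (hF.eq_zero_of_forall_eval_eq_zero_of_le_card (fun x => ?_) ?_)
    · simpa using (eval_F' (Φ.symm x)).symm
    · rw [← Nat.cast_card]
      exact_mod_cast hd
  have preimage_eq : {y | (Fin.tail y : Fin n → K) ∈ S ∧ eval y F' = 0} =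
      Φ ⁻¹' {x | x ∈ X ∧ eval x F = 0} := by
    ext y
    simp only [Set.mem_preimage, Set.mem_ofPred_eq, hX, eval_F', LinearEquiv.coe_coe]
  rw [← Set.ncard_preimage_of_injective_subset_range Φ.injective (by simp), ← preimage_eq]
  exact exists_leadingForm_ncard_le hF' F'_ne_zero S

end VertexCoordinate

section ProjectiveCounting

variable {K : Type*} [Field K]

theorem eval_zero_of_isHomogeneous {ι : Type*} {F : MvPolynomial ι K} {d : ℕ}
    (hF : F.IsHomogeneous d) (hd : d ≠ 0) : eval 0 F = 0 := by
  rw [eval_zero, constantCoeff_eq]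
  exact hF.coeff_eq_zero (by simpa using hd.symm)

variable [Finite K]

theorem ncard_eval_zeros {ι : Type*} [Finite ι] {F : MvPolynomial ι K} {d : ℕ}
    (hF : F.IsHomogeneous d) (hd : d ≠ 0) :
    {v | eval v F = 0}.ncard = 1 + (Nat.card K - 1) * (projZeros F).ncard :=
  ncard_affine_cone (eval_zero_of_isHomogeneous hF hd) (mk_mem_projZeros hF)

theorem ncard_eval_inter_zeros {ι : Type*} [Finite ι] {E F : MvPolynomial ι K} {c d : ℕ}
    (hE : E.IsHomogeneous c) (hc : c ≠ 0) (hF : F.IsHomogeneous d) (hd : d ≠ 0) :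
    {v | eval v E = 0 ∧ eval v F = 0}.ncard =
      1 + (Nat.card K - 1) * (projZeros E ∩ projZeros F).ncard :=
  ncard_affine_cone ⟨eval_zero_of_isHomogeneous hE hc, eval_zero_of_isHomogeneous hF hd⟩
    fun v hv => and_congr (mk_mem_projZeros hE v hv) (mk_mem_projZeros hF v hv)

variable {q : ℕ}

theorem le_one_add_mul_hermitianMax (hq : Nat.card K = q ^ 2) {ι : Type*} [Fintype ι] [Nonempty ι]
    (U : Matrix ι ι K) {G : MvPolynomial ι K} {d : ℕ} (hG : G.IsHomogeneous d) (hG0 : G ≠ 0)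
    (hd : d ≠ 0) {c : ℕ} (hc : 1 + (q ^ 2 - 1) * c ≤
      q ^ 2 * {x | eval x (hermitianPoly q U) = 0 ∧ eval x G = 0}.ncard) :
    c ≤ 1 + q ^ 2 * hermitianMax q d U := by
  have one_lt_sq : 1 < q ^ 2 := hq ▸ Finite.one_lt_card
  rw [ncard_eval_inter_zeros (hermitianPoly_isHomogeneous q U) q.succ_ne_zero hG hd, hq] at hc
  have le_max : (hermitianPoints q U ∩ projZeros G).ncard ≤ hermitianMax q d U :=
    (hermitianMax_isGreatest q d U).2 ⟨G, hG, hG0, rfl⟩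
  refine le_trans ?_ (Nat.add_le_add_left (Nat.mul_le_mul_left _ le_max) 1)
  refine Nat.le_of_mul_le_mul_left (Nat.le_of_add_le_add_left (hc.trans_eq ?_))
    (Nat.sub_pos_of_lt one_lt_sq)
  rw [hermitianPoints]
  zify [one_lt_sq.le]
  ring

theorem ncard_hermitianPoly_inter_zeros_le (hq : Nat.card K = q ^ 2) {m : ℕ}
    {U : Matrix (Fin (m + 3)) (Fin (m + 3)) K} (hU : IsHermitianMatrix q U)
    (hUr : U.rank = m + 3) {G : MvPolynomial (Fin (m + 3)) K} {k : ℕ} (hG : G.IsHomogeneous k)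
    (hG0 : G ≠ 0) (hk : k ≤ q) :
    {x | eval x (hermitianPoly q U) = 0 ∧ eval x G = 0}.ncard ≤
      k * ((q + 1) * q ^ (2 * m + 2)) := by
  have q_pow_pos : 0 < q ^ 4 := pow_pos (zero_lt_two.trans_le (two_le_of_natCard_eq_sq hq)) 4
  refine Nat.le_of_mul_le_mul_left ?_ q_pow_pos
  calc q ^ 4 * {x | eval x (hermitianPoly q U) = 0 ∧ eval x G = 0}.ncard
      ≤ q ^ (2 * Fintype.card (Fin (m + 3))) * (k * (q + 1)) :=
        ncard_hermitianPoly_inter_zeros_mul_le hq hU (by simpa using hUr) (by simp) hG hG0 hk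
    _ = q ^ 4 * (k * ((q + 1) * q ^ (2 * m + 2))) := by
        rw [Fintype.card_fin]
        ring

theorem le_ncard_hermitianPoints_add (hq : Nat.card K = q ^ 2) {m : ℕ}
    {U : Matrix (Fin (m + 3)) (Fin (m + 3)) K} (hU : IsHermitianMatrix q U)
    (hUr : U.rank = m + 3) {G : MvPolynomial (Fin (m + 3)) K} {k e : ℕ} (hG : G.IsHomogeneous k)
    (hG0 : G ≠ 0) (hk : k ≤ q) {c : ℕ} (hc : 1 + (q ^ 2 - 1) * c ≤
      (e + 1) * {x | eval x (hermitianPoly q U) = 0 ∧ eval x G ≠ 0}.ncard +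
        q ^ 2 * {x | eval x (hermitianPoly q U) = 0 ∧ eval x G = 0}.ncard) :
    c ≤ (hermitianPoints q U).ncard + (e + k) * ((q + 1) * q ^ (2 * m + 2)) := by
  have one_lt_sq : 1 < q ^ 2 := hq ▸ Finite.one_lt_card
  have card_U := ncard_eval_zeros (hermitianPoly_isHomogeneous q U) q.succ_ne_zero
  have card_U_add_le := ncard_hermitianPoly_zeros_add_le hq hU hUr
  have zeros_le := ncard_hermitianPoly_inter_zeros_le hq hU hUr hG hG0 hk
  have split : {x | eval x (hermitianPoly q U) = 0 ∧ eval x G = 0}.ncard +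
      {x | eval x (hermitianPoly q U) = 0 ∧ eval x G ≠ 0}.ncard =
      {x | eval x (hermitianPoly q U) = 0}.ncard :=
    Set.ncard_inter_add_ncard_sdiff_eq_ncard _ {x | eval x G = 0}
  rw [hq] at card_U
  rw [hermitianPoints]
  set Z := {x | eval x (hermitianPoly q U) = 0 ∧ eval x G = 0}.ncard
  set A := {x | eval x (hermitianPoly q U) = 0 ∧ eval x G ≠ 0}.ncard
  set D := (q + 1) * q ^ (2 * m + 2) with hD
  obtain ⟨w, hw⟩ : ∃ w, q ^ 2 = w + 1 := Nat.exists_eq_succ_of_ne_zero (by omega)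
  have D_mul : (q + 1) * q ^ (2 * m + 4) = w * D + D := by
    rw [← Nat.succ_mul, ← Nat.add_one, ← hw, hD]
    ring
  have card_U_le : 1 + w * (projZeros (hermitianPoly q U)).ncard ≤ w * D := by
    rwa [D_mul, add_le_add_iff_right, card_U, hw, Nat.add_sub_cancel] at card_U_add_le
  rw [card_U, hw, Nat.add_sub_cancel] at split
  rw [hw, Nat.add_sub_cancel] at hc
  refine Nat.le_of_mul_le_mul_left (Nat.le_of_add_le_add_left (a := 1) ?_)
    (show 0 < w by omega)
  calc 1 + w * c ≤ (e + 1) * A + (w + 1) * Z := hc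
    _ ≤ (Z + A) + e * (Z + A) + w * Z := by nlinarith [Nat.zero_le (e * Z)]
    _ ≤ (1 + w * (projZeros (hermitianPoly q U)).ncard) + e * (w * D) + w * (k * D) := by
        rw [split]
        gcongr
    _ = 1 + w * ((projZeros (hermitianPoly q U)).ncard + (e + k) * D) := by ring

end ProjectiveCounting

theorem mainTheorem2 {K : Type*} [Field K] [Finite K] (q n d : ℕ)
    (hq : Nat.card K = q ^ 2) (hn : 3 ≤ n) (hd : 1 ≤ d) (hdq : d ≤ q)
    -- the Hermitian variety of rank `n` in `ℙⁿ`
    (H : Matrix (Fin (n + 1)) (Fin (n + 1)) K) (hH : IsHermitianMatrix q H) (hHr : H.rank = n)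
    -- a non-degenerate Hermitian variety in `ℙⁿ⁻¹`
    (U : Matrix (Fin n) (Fin n) K) (hU : IsHermitianMatrix q U) (hUr : U.rank = n)
    -- a hypersurface of degree `d` in `ℙⁿ`
    (F : MvPolynomial (Fin (n + 1)) K) (hF : F.IsHomogeneous d) (hF0 : F ≠ 0) :
    (hermitianPoints q H ∩ projZeros F).ncard ≤
      max ((hermitianPoints q U).ncard + (d - 1) * (q + 1) * q ^ (2 * n - 4))
        (1 + q ^ 2 * hermitianMax q d U) := by
  obtain ⟨m, rfl⟩ := Nat.exists_eq_add_of_le' hn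
  obtain ⟨Φ, hΦ⟩ := exists_linearEquiv_eval_hermitianPoly_eq hq hH hHr hU hUr
  obtain ⟨e, hed, G, hG, hG0, hle⟩ := exists_leadingForm_ncard_le_of_linearEquiv hF hF0
    (hdq.trans (hq ▸ Nat.le_self_pow two_ne_zero q)) Φ
    (X := {x | eval x (hermitianPoly q H) = 0}) (S := {x | eval x (hermitianPoly q U) = 0})
    fun y => by rw [Set.mem_ofPred_eq, Set.mem_ofPred_eq, hΦ]
  simp only [Set.mem_ofPred_eq] at hle
  rw [ncard_eval_inter_zeros (hermitianPoly_isHomogeneous q H) q.succ_ne_zero hF (by omega),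
    hq] at hle
  rcases e with _ | e
  · rw [zero_mul, zero_add] at hle
    exact le_max_of_le_right (le_one_add_mul_hermitianMax hq U hG hG0 (by omega) hle)
  · refine le_max_of_le_left ?_
    have hcard := le_ncard_hermitianPoints_add hq hU hUr hG hG0 (by omega) hle
    rwa [show e + (d - (e + 1)) = d - 1 by omega, ← mul_assoc,
      show 2 * m + 2 = 2 * (m + 3) - 4 by omega] at hcard
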